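/- **Theorem.** Let $d$ be a prime, $\omega=e^{2\pi i/d}$, and let $T_1,\dots,T_k$ be unitary operators on a nonzero finite-dimensional complex Hilbert space $\mathcal H$ with $T_i^d=\mathbb 1$. Suppose that for all $i,j$ $$T_iT_jT_i^{-1}T_j^{-1}=\omega^{\gamma_{i,j}}\,\mathbb 1,\qquad \gamma_{i,j}\in\mathbb Z_d ,$$ and let $\gamma=(\gamma_{i,j})\in M_{k\times k}(\mathbb Z_d)$ (the adjacency matrix of the generating graph). For $I\in\mathbb Z_d^k$ put $A_I=\alpha_I\,T_1^{I_1}T_2^{I_2}\cdots T_k^{I_k}$, where $\alpha_I\in\{1,\mathbb i\}$ is chosen so that $A_I^d=\mathbb 1$, and let $\mathcal A=\{A_I : I\in\mathbb Z_d^k\}$, with group operation $A_I\odot A_J=A_{I+J}$. On $\mathbb C^d$ with basis $\{|j\rangle\}_{j\in\mathbb Z_d}$ let $X=\sum_j|j+1\rangle\langle j|$ and $Z=\sum_j\omega^j|j\rangle\langle j|$, and let $\tilde{\mathbb P}_N$ be the set of all operators $$\mu\; X^{i_1}Z^{j_1}\otimes\cdots\otimes X^{i_N}Z^{j_N}\quad\text{on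 }(\mathbb C^d)^{\otimes N},$$ where $i,j\in\mathbb Z_d^N$ and $\mu\in\{1,\mathbb i\}$ is chosen so that the $d$-th power of the operator is $\mathbb 1$. Then the rank $q$ of $\gamma$ over the field $\mathbb Z_d$ is even, and there exist a finite-dimensional Hilbert space $\mathcal H'$ and a single unitary $U:\mathcal H\to(\mathbb C^d)^{\otimes q/2}\otimes\mathcal H'$ such that for every $A\in\mathcal A$ $$U A\,U^\dagger=P_A\otimes C_A ,$$ where $P_A\in\tilde{\mathbb P}_{q/2}$, $C_A$ is a unitary on $\mathcal H'$ with $C_A^d=\mathbb 1$, and $C_AC_{A'}=C_{A'}C_A$ for all $A,A'\in\mathcal A$. -/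

import Mathlib

open scoped Kronecker

noncomputable section

namespace FrustrationGraph

/-- The primitive root of unity `ω = exp(2πi/d)`. -/
def rootOfUnity (d : ℕ) : ℂ := Complex.exp (2 * Real.pi * Complex.I / d)

/-- `ω ^ l` for a residue class `l` modulo `d`. -/
def rootPow (d : ℕ) (l : ZMod d) : ℂ := rootOfUnity d ^ l.val

/-! ### Generalized Pauli matrices on `N` qudits -/

/-- The shift matrix `X = ∑ⱼ |j+1⟩⟨j|` on `ℂ^d`, with basis indexed by `ZMod d`. -/
def shiftX (d : ℕ) : Matrix (ZMod d) (ZMod d) ℂ :=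
  Matrix.of fun a b => if a = b + 1 then 1 else 0

/-- The clock matrix `Z = ∑ⱼ ω^j |j⟩⟨j|` on `ℂ^d`. -/
def clockZ (d : ℕ) : Matrix (ZMod d) (ZMod d) ℂ :=
  Matrix.diagonal fun a => rootPow d a

/-- The tensor product `M₁ ⊗ ⋯ ⊗ M_N` of matrices on `ℂ^d`, as a matrix on `(ℂ^d)^{⊗N}` in the
product basis `|f₁⟩ ⊗ ⋯ ⊗ |f_N⟩`, which is indexed by the functions `f : Fin N → ZMod d`. -/
def tensorMatrix {d N : ℕ} (M : Fin N → Matrix (ZMod d) (ZMod d) ℂ) :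
    Matrix (Fin N → ZMod d) (Fin N → ZMod d) ℂ :=
  Matrix.of fun f g => ∏ l, M l (f l) (g l)

/-- The set of the `N`-fold tensor products `W = μ X^{i₁}Z^{j₁} ⊗ ⋯ ⊗ X^{i_N}Z^{j_N}` with
`i, j ∈ (ℤ/d)^N`, where `μ ∈ {1, i}` is chosen so that `W ^ d = 1`. -/
def pauliSet (d N : ℕ) [NeZero d] : Set (Matrix (Fin N → ZMod d) (Fin N → ZMod d) ℂ) :=
  {W | ∃ (i j : Fin N → ZMod d) (μ : ℂ), (μ = 1 ∨ μ = Complex.I) ∧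
    W = μ • tensorMatrix (fun l => shiftX d ^ (i l).val * clockZ d ^ (j l).val) ∧ W ^ d = 1}

/-! ### The set of operators generated by `T₁, …, T_k` -/

variable {H : Type*} [NormedAddCommGroup H] [InnerProductSpace ℂ H] [CompleteSpace H]

/-- The ordered product `T₁^{I₁} T₂^{I₂} ⋯ T_k^{I_k}`. -/
def word {d k : ℕ} (T : Fin k → unitary (H →L[ℂ] H)) (I : Fin k → ZMod d) :
    unitary (H →L[ℂ] H) :=
  (List.ofFn fun i => T i ^ (I i).val).prod

open Classical in
/-- The phase `α_I ∈ {1, i}` with `(α_I T₁^{I₁} ⋯ T_k^{I_k}) ^ d = 1`. -/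
def phase {d k : ℕ} (T : Fin k → unitary (H →L[ℂ] H)) (I : Fin k → ZMod d) : ℂ :=
  if word T I ^ d = 1 then 1 else Complex.I

/-- The operator `A_I = α_I T₁^{I₁} ⋯ T_k^{I_k}`. -/
def element {d k : ℕ} (T : Fin k → unitary (H →L[ℂ] H)) (I : Fin k → ZMod d) : H →L[ℂ] H :=
  phase T I • (word T I : H →L[ℂ] H)

/-- For prime `d` the phase in `element` is the only admissible one: every `α ∈ {1, i}` with
`(α T₁^{I₁} ⋯ T_k^{I_k}) ^ d = 1` yields the same operator. -/
theorem element_eq_of_pow_eq_one [Nontrivial H] {d k : ℕ} (hd : d.Prime)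
    (T : Fin k → unitary (H →L[ℂ] H)) (I : Fin k → ZMod d) (α : ℂ)
    (hα : α = 1 ∨ α = Complex.I) (h : (α • (word T I : H →L[ℂ] H)) ^ d = 1) :
    α • (word T I : H →L[ℂ] H) = element T I := by
  unfold element phase
  split_ifs with hw
  · rcases hα with rfl | rfl
    · rfl
    · exfalso
      have hw' : (word T I : H →L[ℂ] H) ^ d = 1 := by
        rw [← SubmonoidClass.coe_pow, hw]; rfl
      rw [smul_pow, hw'] at h
      have h1 : Complex.I ^ d = 1 := by
        obtain ⟨x, hx⟩ := exists_ne (0 : H)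
        have h2 := congrArg (fun f : H →L[ℂ] H => f x) h
        simp only [smul_apply, one_apply_eq_self] at h2
        exact smul_left_injective ℂ hx (by simpa using h2)
      have h4 : orderOf Complex.I ∣ d := orderOf_dvd_of_pow_eq_one h1
      rw [(orderOf_eq_prime_pow (p := 2) (n := 1) (x := Complex.I)
        (by norm_num) (by norm_num [Complex.I_pow_four]))] at h4
      rcases (Nat.dvd_prime hd).1 (dvd_trans (by norm_num : 2 ∣ 2 ^ (1 + 1)) h4) with h5 | h5
      · norm_num at h5
      · subst h5; norm_num at h4
  · rcases hα with rfl | rfl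
    · refine absurd (Subtype.ext ?_) hw
      rw [one_smul] at h
      simpa using h
    · rfl

/-- The set `𝒜 = {A_I : I ∈ (ℤ/d)^k}` generated by `T₁, …, T_k`; its group operation is
`A_I ⊙ A_J = A_{I+J}`. -/
def generatedSet (d : ℕ) {k : ℕ} (T : Fin k → unitary (H →L[ℂ] H)) : Set (H →L[ℂ] H) :=
  Set.range fun I : Fin k → ZMod d => element T I

/-- `γ` is the adjacency matrix of the generating graph of `T₁, …, T_k`: the group commutators
are `T_i T_j T_i⁻¹ T_j⁻¹ = ω^{γ_{ij}} 1`. -/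
def IsGeneratingGraph (d : ℕ) {k : ℕ} (T : Fin k → unitary (H →L[ℂ] H))
    (γ : Matrix (Fin k) (Fin k) (ZMod d)) : Prop :=
  ∀ i j, ((T i * T j * (T i)⁻¹ * (T j)⁻¹ : unitary (H →L[ℂ] H)) : H →L[ℂ] H) =
    rootPow d (γ i j) • 1

end FrustrationGraph

end

/-!
The exponent vectors `v ∈ (ℤ/d)^k` of products of the `T i` carry the bilinear form `B` of `γ`, and
two products with exponent vectors `u`, `v` commute up to `ω ^ B(u, v)`
(`TwistedProduct.mul_eq`). Since an operator commutes with itself, `B` is alternating. Hence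
`(ℤ/d)^k` is the orthogonal sum of the radical of `B` and the span of a symplectic family
`e₁, …, e_N, f₁, …, f_N` (`exists_isSymplecticFamily`), and `γ` has rank `2N`
(`IsSymplecticFamily.rank_eq`).

The operators with exponent vectors `e_l` and `f_l`, with their phases normalized so that their
`d`-th powers are `1`, satisfy the relations of the Pauli operators `X_l` and `Z_l`. By the finite
Stone-von Neumann theorem they are these operators up to a multiplicity space. The basis is
explicit: if `(u_s)` is an orthonormal basis of the joint fixed space of the `Z`-type operators,
translating it by the products `E f` of the `X`-type operators gives an orthonormal basis
`(E f u_s)` of the whole space (`IsWeylSystem.basis`). In it the commutant of the Weyl system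
consists of the operators `1 ⊗ C` (`IsWeylSystem.exists_conj_eq_one_kronecker`).

Finally, `A_I = s R`, where `s` is a Pauli operator with the same commutators with the `e_l` and
`f_l` as `A_I`, normalized so that `s ^ d = 1`. The exponent vector of `R` lies in the radical, so
the operators `R` commute with each other and with the Weyl system; hence `R = 1 ⊗ C`, and
`A_I = P ⊗ C` with commuting factors `C`, each of order dividing `d`.
-/

namespace FrustrationGraph

/-! ### Symplectic families in alternating spaces -/

section Symplectic

variable {𝕜 V : Type*} [Field 𝕜] [AddCommGroup V] [Module 𝕜 V]

/-- `e₁, …, e_N, f₁, …, f_N` satisfy the relations of a symplectic basis for `B`, normalized by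
`B fᵢ eⱼ = δᵢⱼ`. They need not span the whole space. -/
structure IsSymplecticFamily (B : LinearMap.BilinForm 𝕜 V) {N : ℕ} (e f : Fin N → V) : Prop where
  left : ∀ i j, B (e i) (e j) = 0
  right : ∀ i j, B (f i) (f j) = 0
  pairing : ∀ i j, B (f i) (e j) = if i = j then 1 else 0

variable {B : LinearMap.BilinForm 𝕜 V} {N : ℕ} {e f : Fin N → V}

/-- The remainder of `v` after its component in the span of a symplectic family is removed. -/
def symplecticRemainder (B : LinearMap.BilinForm 𝕜 V) (e f : Fin N → V) (v : V) : V :=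
  v - (∑ l, B (f l) v • e l + ∑ l, B v (e l) • f l)

namespace IsSymplecticFamily

theorem pairing_swap (h : IsSymplecticFamily B e f) (hB : B.IsAlt) (i j : Fin N) :
    B (e i) (f j) = -(if j = i then 1 else 0) := by
  rw [← h.pairing, hB.neg_eq]

theorem apply_left_sum (h : IsSymplecticFamily B e f) (x : Fin N → 𝕜) (m : Fin N) :
    B (f m) (∑ l, x l • e l) = x m := by
  simp [h.pairing]

theorem apply_right_sum (h : IsSymplecticFamily B e f) (hB : B.IsAlt) (x : Fin N → 𝕜)
    (m : Fin N) : B (e m) (∑ l, x l • f l) = -x m := by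
  simp [h.pairing_swap hB]

theorem apply_remainder_left (h : IsSymplecticFamily B e f) (hB : B.IsAlt) (v : V) (m : Fin N) :
    B (e m) (symplecticRemainder B e f v) = 0 := by
  have h0 : B (e m) (∑ l, B (f l) v • e l) = 0 := by simp [h.left]
  rw [symplecticRemainder, map_sub, map_add, h0, h.apply_right_sum hB, ← hB.neg_eq (x := v)]
  simp

theorem apply_remainder_right (h : IsSymplecticFamily B e f) (v : V) (m : Fin N) :
    B (f m) (symplecticRemainder B e f v) = 0 := by
  have h0 : B (f m) (∑ l, B v (e l) • f l) = 0 := by simp [h.right]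
  rw [symplecticRemainder, map_sub, map_add, h0, h.apply_left_sum]
  simp

theorem linearIndependent_left (h : IsSymplecticFamily B e f) : LinearIndependent 𝕜 e := by
  rw [Fintype.linearIndependent_iff]
  intro g hg i
  simpa [hg] using (h.apply_left_sum g i).symm

/-- A symplectic family is enlarged by a pair of vectors orthogonal to it that are not orthogonal
to each other. -/
theorem extend (h : IsSymplecticFamily B e f) (hB : B.IsAlt) {v w : V}
    (hve : ∀ i, B (e i) v = 0) (hvf : ∀ i, B (f i) v = 0)
    (hwe : ∀ i, B (e i) w = 0) (hwf : ∀ i, B (f i) w = 0) (hvw : B v w ≠ 0) :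
    IsSymplecticFamily B (Fin.cons w e : Fin (N + 1) → V)
      (Fin.cons ((B v w)⁻¹ • v) f : Fin (N + 1) → V) := by
  have hev (i) : B v (e i) = 0 := by rw [← hB.neg_eq, hve, neg_zero]
  have hew (i) : B w (e i) = 0 := by rw [← hB.neg_eq, hwe, neg_zero]
  have hfv (i) : B v (f i) = 0 := by rw [← hB.neg_eq, hvf, neg_zero]
  refine ⟨fun i j => ?_, fun i j => ?_, fun i j => ?_⟩ <;>
    refine Fin.cases ?_ (fun i => ?_) i <;> refine Fin.cases ?_ (fun j => ?_) j <;>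
    simp [h.left, h.right, h.pairing, hwe, hwf, hev, hew, hvf, hfv, hB.self_eq_zero, hvw,
      Fin.succ_ne_zero, (Fin.succ_ne_zero _).symm]

end IsSymplecticFamily

/-- An alternating space is the orthogonal sum of its radical and the span of a symplectic family:
a family of maximal size does it. -/
theorem exists_isSymplecticFamily [FiniteDimensional 𝕜 V] (hB : B.IsAlt) :
    ∃ (N : ℕ) (e f : Fin N → V), IsSymplecticFamily B e f ∧
      ∀ v, (∀ i, B (e i) v = 0) → (∀ i, B (f i) v = 0) → ∀ w, B v w = 0 := by
  classical
  let p : ℕ → Prop := fun N => ∃ e f : Fin N → V, IsSymplecticFamily B e f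
  have hp0 : p 0 := ⟨Fin.elim0, Fin.elim0, ⟨fun i => i.elim0, fun i => i.elim0, fun i => i.elim0⟩⟩
  obtain ⟨e, f, hef⟩ := Nat.findGreatest_spec (P := p) (Nat.zero_le (Module.finrank 𝕜 V)) hp0
  refine ⟨_, e, f, hef, fun v hve hvf w => ?_⟩
  by_contra hvw
  have hv : B v (symplecticRemainder B e f w) = B v w := by
    have hev (i) : B v (e i) = 0 := by rw [← hB.neg_eq, hve, neg_zero]
    have hfv (i) : B v (f i) = 0 := by rw [← hB.neg_eq, hvf, neg_zero]
    simp [symplecticRemainder, hev, hfv]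
  have h := hef.extend hB hve hvf (hef.apply_remainder_left hB w) (hef.apply_remainder_right w)
    (by rwa [hv])
  have hle := h.linearIndependent_left.fintype_card_le_finrank
  rw [Fintype.card_fin] at hle
  exact absurd (Nat.le_findGreatest hle (show p _ from ⟨_, _, h⟩)) (Nat.not_succ_le_self _)

/-- The rank of an alternating matrix is the size of a symplectic family that spans a complement
of the radical. -/
theorem IsSymplecticFamily.rank_eq {k : ℕ} {γ : Matrix (Fin k) (Fin k) 𝕜}
    {e f : Fin N → Fin k → 𝕜} (h : IsSymplecticFamily γ.toBilin' e f) (hB : γ.toBilin'.IsAlt)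
    (hrad : ∀ v, (∀ i, γ.toBilin' (e i) v = 0) → (∀ i, γ.toBilin' (f i) v = 0) →
      ∀ w, γ.toBilin' v w = 0) : γ.rank = 2 * N := by
  let Ψ : (Fin k → 𝕜) →ₗ[𝕜] (Fin N → 𝕜) × (Fin N → 𝕜) :=
    (LinearMap.pi fun i => γ.toBilin' (e i)).prod (LinearMap.pi fun i => γ.toBilin' (f i))
  have hsurj : Function.Surjective Ψ := by
    rintro ⟨x, y⟩
    refine ⟨∑ l, y l • e l - ∑ l, x l • f l, ?_⟩
    have h1 (m) : γ.toBilin' (e m) (∑ l, y l • e l) = 0 := by simp [h.left]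
    have h2 (m) : γ.toBilin' (f m) (∑ l, x l • f l) = 0 := by simp [h.right]
    refine Prod.ext (funext fun m => ?_) (funext fun m => ?_)
    · change γ.toBilin' (e m) _ = x m
      rw [map_sub, h1, h.apply_right_sum hB, zero_sub, neg_neg]
    · change γ.toBilin' (f m) _ = y m
      rw [map_sub, h2, h.apply_left_sum, sub_zero]
  have hker : LinearMap.ker Ψ = LinearMap.ker γ.mulVecLin := by
    ext v
    simp only [LinearMap.mem_ker]
    constructor
    · intro hv
      have he (i) : γ.toBilin' (e i) v = 0 := congrFun (congrArg Prod.fst hv) i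
      have hf (i) : γ.toBilin' (f i) v = 0 := congrFun (congrArg Prod.snd hv) i
      refine dotProduct_eq_zero _ fun w => ?_
      rw [dotProduct_comm]
      change w ⬝ᵥ γ.mulVec v = 0
      rw [← Matrix.toBilin'_apply', ← hB.neg_eq, hrad v he hf, neg_zero]
    · intro hv
      have hv' (u) : γ.toBilin' u v = 0 := by
        rw [Matrix.toBilin'_apply', show γ.mulVec v = 0 from hv, dotProduct_zero]
      exact Prod.ext (funext fun i => hv' _) (funext fun i => hv' _)
  have h1 := Ψ.finrank_range_add_finrank_ker
  have h2 := γ.mulVecLin.finrank_range_add_finrank_ker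
  rw [LinearMap.range_eq_top.2 hsurj, hker] at h1
  rw [Matrix.rank]
  simp at h1 h2
  omega

end Symplectic

/-! ### Products in a group whose commutators are central phases -/

section TwistedProduct

variable {d : ℕ} {G : Type*} [Group G] {ζ : AddChar (ZMod d) G}

/-- If `b a = w a b` with `w` commuting with `a` and `b`, then
`(a b)ⁿ = w ^ (n choose 2) aⁿ bⁿ`. -/
theorem mul_pow_of_commutator {a b w : G} (hwa : Commute w a) (hwb : Commute w b)
    (h : b * a = w * (a * b)) (n : ℕ) : (a * b) ^ n = w ^ n.choose 2 * (a ^ n * b ^ n) := by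
  have hn (n : ℕ) : b ^ n * a = w ^ n * (a * b ^ n) := by
    induction n with
    | zero => simp
    | succ n ih =>
      rw [pow_succ', mul_assoc, ih, ← mul_assoc, ← (hwb.pow_left n).eq, mul_assoc, ← mul_assoc b,
        h, pow_succ]
      simp only [mul_assoc]
  induction n with
  | zero => simp
  | succ n ih =>
    rw [pow_succ, ih, Nat.choose_succ_succ' n 1, Nat.choose_one_right, add_comm, pow_add,
      pow_succ a, pow_succ b]
    calc w ^ n.choose 2 * (a ^ n * b ^ n) * (a * b)
        = w ^ n.choose 2 * (a ^ n * (b ^ n * a) * b) := by simp only [mul_assoc]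
      _ = w ^ n.choose 2 * (a ^ n * w ^ n * (a * b ^ n * b)) := by rw [hn]; simp only [mul_assoc]
      _ = _ := by rw [← (hwa.pow_pow n n).eq]; simp only [mul_assoc]

/-- The ordered product `T₁^{x₁} ⋯ T_n^{x_n}` in a group, with the exponents represented in
`{0, …, d-1}`; `word` is the case of the unitary group. -/
def orderedProd {n : ℕ} (T : Fin n → G) (x : Fin n → ZMod d) : G :=
  (List.ofFn fun i => T i ^ (x i).val).prod

theorem orderedProd_add [NeZero d] {n : ℕ} {T : Fin n → G} (hT : ∀ i, T i ^ d = 1)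
    (hcomm : ∀ i j, Commute (T i) (T j)) (x y : Fin n → ZMod d) :
    orderedProd T (x + y) = orderedProd T x * orderedProd T y := by
  induction n with
  | zero => simp [orderedProd]
  | succ n ih =>
    have hc : Commute (T 0 ^ (y 0).val) (orderedProd (fun i => T (Fin.succ i))
        fun i => x (Fin.succ i)) := by
      refine Commute.list_prod_right _ _ fun g hg => ?_
      obtain ⟨i, rfl⟩ := (List.mem_ofFn' _ _).1 hg
      exact (hcomm _ _).pow_pow _ _
    have hp : T 0 ^ ((x + y) 0).val = T 0 ^ (x 0).val * T 0 ^ (y 0).val := by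
      rw [← pow_add, Pi.add_apply, ZMod.val_add, ← pow_mod_orderOf, Nat.mod_mod_of_dvd _
        (orderOf_dvd_of_pow_eq_one (hT 0)), pow_mod_orderOf]
    have key (x : Fin (n + 1) → ZMod d) : orderedProd T x = T 0 ^ (x 0).val *
        orderedProd (fun i => T (Fin.succ i)) fun i => x (Fin.succ i) := by
      simp [orderedProd, List.ofFn_succ]
    have ih' := ih (T := fun i => T (Fin.succ i)) (fun i => hT _) (fun i j => hcomm _ _)
      (fun i => x (Fin.succ i)) (fun i => y (Fin.succ i))
    rw [key, key x, key y, hp, mul_assoc, mul_assoc, ← mul_assoc (orderedProd _ _), ← hc.eq]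
    rw [mul_assoc]
    exact congrArg _ (congrArg _ ih')

variable {k : ℕ}

/-- `TwistedProduct ζ T a v` says that `a` is a product of central elements and of factors
`T i`, in any order, in which `T i` occurs `v i` times modulo `d`. The central factors allowed are
those whose `d`-th power is `ζ (c · d(d-1)/2)` for some `c`, which is also the form of the `d`-th
power of a product of the `T i`. -/
inductive TwistedProduct (ζ : AddChar (ZMod d) G) (T : Fin k → G) : G → (Fin k → ZMod d) → Prop
  | of (i : Fin k) : TwistedProduct ζ T (T i) (Pi.single i 1)
  | central (g : G) (hg : ∀ h, Commute g h) (hpow : ∃ c, g ^ d = ζ ((d.choose 2 : ℕ) * c)) :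
      TwistedProduct ζ T g 0
  | mul {a b : G} {u v : Fin k → ZMod d} (ha : TwistedProduct ζ T a u)
      (hb : TwistedProduct ζ T b v) : TwistedProduct ζ T (a * b) (u + v)

namespace TwistedProduct

variable {T : Fin k → G} {a b : G} {u v : Fin k → ZMod d}

theorem one : TwistedProduct ζ T 1 0 :=
  central 1 (fun h => Commute.one_left h) ⟨0, by simp⟩

theorem pow (ha : TwistedProduct ζ T a u) (n : ℕ) : TwistedProduct ζ T (a ^ n) (n • u) := by
  induction n with
  | zero => simpa using one
  | succ n ih => rw [pow_succ, succ_nsmul]; exact ih.mul ha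

theorem inv (ha : TwistedProduct ζ T a u) (hd : 0 < d) (hpow : a ^ d = 1) :
    TwistedProduct ζ T a⁻¹ (-u) := by
  have h1 : a⁻¹ = a ^ (d - 1) := by
    rw [inv_eq_iff_mul_eq_one, ← pow_succ', Nat.sub_add_cancel hd, hpow]
  have h2 : -u = (d - 1) • u := by
    ext i
    simp [nsmul_eq_mul, Nat.cast_sub (Nat.succ_le_of_lt hd)]
  rw [h1, h2]
  exact ha.pow _

theorem list_prod {n : ℕ} {g : Fin n → G} {w : Fin n → Fin k → ZMod d}
    (h : ∀ i, TwistedProduct ζ T (g i) (w i)) :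
    TwistedProduct ζ T (List.ofFn g).prod (∑ i, w i) := by
  induction n with
  | zero => simpa using one
  | succ n ih =>
    rw [List.ofFn_succ, List.prod_cons, Fin.sum_univ_succ]
    exact (h 0).mul (ih fun i => h _)

theorem orderedProd [NeZero d] {n : ℕ} {g : Fin n → G} {w : Fin n → Fin k → ZMod d}
    (h : ∀ i, TwistedProduct ζ T (g i) (w i)) (x : Fin n → ZMod d) :
    TwistedProduct ζ T (orderedProd g x) (∑ i, x i • w i) := by
  have h1 : ∑ i, x i • w i = ∑ i, (x i).val • w i := by
    refine Finset.sum_congr rfl fun i _ => ?_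
    rw [← Nat.cast_smul_eq_nsmul (ZMod d), ZMod.natCast_zmod_val]
  rw [h1]
  exact list_prod fun i => (h i).pow _

variable {γ : Matrix (Fin k) (Fin k) (ZMod d)}

/-- The commutator of two products is determined by their exponent vectors, through the bilinear
form of the commutator matrix of the generators. -/
theorem mul_eq (hζ : ∀ c g, Commute (ζ c) g)
    (hT : ∀ i j, T i * T j = ζ (γ i j) * (T j * T i))
    (ha : TwistedProduct ζ T a u) (hb : TwistedProduct ζ T b v) :
    a * b = ζ (γ.toBilin' u v) * (b * a) := by
  induction ha with
  | central g hg _ => simpa using (hg b).eq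
  | @mul a₁ a₂ u₁ u₂ _ _ h₁ h₂ =>
    rw [mul_assoc, h₂, ← mul_assoc, ← (hζ _ a₁).eq, mul_assoc, ← mul_assoc a₁, h₁, map_add,
      LinearMap.add_apply, add_comm, AddChar.map_add_eq_mul]
    simp only [mul_assoc]
  | of i =>
    induction hb with
    | central g hg _ => simpa using (hg _).eq.symm
    | @mul b₁ b₂ v₁ v₂ _ _ h₁ h₂ =>
      rw [← mul_assoc, h₁, mul_assoc, mul_assoc, h₂, ← mul_assoc b₁, ← (hζ _ b₁).eq, map_add,
        AddChar.map_add_eq_mul]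
      simp only [mul_assoc]
    | of j => rw [hT, Matrix.toBilin'_single]

theorem commute (hζ : ∀ c g, Commute (ζ c) g)
    (hT : ∀ i j, T i * T j = ζ (γ i j) * (T j * T i))
    (ha : TwistedProduct ζ T a u) (hb : TwistedProduct ζ T b v) (h : γ.toBilin' u v = 0) :
    Commute a b := by
  rw [commute_iff_eq, ha.mul_eq hζ hT hb, h, AddChar.map_zero_eq_one, one_mul]

theorem exists_pow_eq (hζ : ∀ c g, Commute (ζ c) g)
    (hT : ∀ i j, T i * T j = ζ (γ i j) * (T j * T i)) (hTd : ∀ i, T i ^ d = 1)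
    (ha : TwistedProduct ζ T a u) : ∃ c, a ^ d = ζ ((d.choose 2 : ℕ) * c) := by
  induction ha with
  | of i => exact ⟨0, by simp [hTd]⟩
  | central g hg hpow => exact hpow
  | @mul a b u v ha hb iha ihb =>
    obtain ⟨c, hc⟩ := iha
    obtain ⟨c', hc'⟩ := ihb
    refine ⟨γ.toBilin' v u + c + c', ?_⟩
    rw [mul_pow_of_commutator (hζ _ a) (hζ _ b) (hb.mul_eq hζ hT ha), hc, hc',
      ← AddChar.map_nsmul_eq_pow, ← AddChar.map_add_eq_mul, ← AddChar.map_add_eq_mul, nsmul_eq_mul]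
    congr 1
    ring

end TwistedProduct

end TwistedProduct

/-! ### Scalar unitaries -/

section Scalar

theorem rootPow_eq_stdAddChar {d : ℕ} [NeZero d] (c : ZMod d) :
    rootPow d c = ZMod.stdAddChar c := by
  rw [ZMod.stdAddChar_apply, ZMod.toCircle_apply, rootPow, rootOfUnity, ← Complex.exp_nat_mul]
  congr 1
  ring

variable (H : Type*) [NormedAddCommGroup H] [InnerProductSpace ℂ H] [CompleteSpace H]

/-- The scalar operators of modulus one, as unitaries. -/
noncomputable def scalarUnitary : Circle →* unitary (H →L[ℂ] H) where
  toFun z := ⟨(z : ℂ) • 1, by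
    have h : (starRingEnd ℂ) (z : ℂ) * z = 1 := by
      rw [← Complex.normSq_eq_conj_mul_self, Circle.normSq_coe, Complex.ofReal_one]
    rw [Unitary.mem_iff, star_smul, star_one, smul_mul_smul_comm, smul_mul_smul_comm, mul_one]
    constructor
    · rw [Complex.star_def, h, one_smul]
    · rw [Complex.star_def, mul_comm, h, one_smul]⟩
  map_one' := Subtype.ext (by simp)
  map_mul' z w := Subtype.ext (by simp [smul_smul, mul_comm])

/-- The `d`-th roots of unity as scalar operators. -/
noncomputable def scalarChar (d : ℕ) [NeZero d] : AddChar (ZMod d) (unitary (H →L[ℂ] H)) :=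
  (scalarUnitary H).compAddChar ZMod.toCircle

variable {H}

theorem coe_scalarUnitary (z : Circle) :
    (scalarUnitary H z : H →L[ℂ] H) = (z : ℂ) • 1 := rfl

theorem coe_scalarChar {d : ℕ} [NeZero d] (c : ZMod d) :
    (scalarChar H d c : H →L[ℂ] H) = (ZMod.stdAddChar c : ℂ) • 1 := rfl

theorem scalarUnitary_commute (z : Circle) (g : unitary (H →L[ℂ] H)) :
    Commute (scalarUnitary H z) g :=
  Subtype.ext (by simp [coe_scalarUnitary])

theorem scalarChar_commute {d : ℕ} [NeZero d] (c : ZMod d) (g : unitary (H →L[ℂ] H)) :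
    Commute (scalarChar H d c) g :=
  scalarUnitary_commute _ g

end Scalar

/-! ### Matrices of operators and of Pauli products -/

section Matrices

variable {H : Type*} [NormedAddCommGroup H] [InnerProductSpace ℂ H] [CompleteSpace H]

theorem conj_repr_eq_toEuclideanCLM {ι : Type*} [Fintype ι] [DecidableEq ι]
    (b : OrthonormalBasis ι ℂ H) {A : H →L[ℂ] H} {M : Matrix ι ι ℂ}
    (h : ∀ j, A (b j) = ∑ i, M i j • b i) :
    b.repr.conjStarAlgEquiv A = Matrix.toEuclideanCLM (𝕜 := ℂ) M := by
  apply ContinuousLinearMap.coe_injective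
  refine (EuclideanSpace.basisFun ι ℂ).toBasis.ext fun j => ?_
  ext i
  simp [h, b.repr_self, Pi.single_apply]

theorem shiftX_pow_apply {d : ℕ} [NeZero d] (n : ℕ) (a b : ZMod d) :
    (shiftX d ^ n) a b = if a = b + n then 1 else 0 := by
  induction n generalizing a with
  | zero => simp [Matrix.one_apply]
  | succ n ih =>
    rw [pow_succ', Matrix.mul_apply]
    simp only [ih]
    simp [shiftX, add_assoc]

/-- `X^x Z^z |g⟩ = ω^{g·z} |g+x⟩`, for tensor products of Pauli matrices. -/
theorem tensorMatrix_pauli_apply {d N : ℕ} [NeZero d] (x z f g : Fin N → ZMod d) :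
    tensorMatrix (fun l => shiftX d ^ (x l).val * clockZ d ^ (z l).val) f g =
      if f = g + x then (ZMod.stdAddChar (g ⬝ᵥ z) : ℂ) else 0 := by
  have h (l) : (shiftX d ^ (x l).val * clockZ d ^ (z l).val) (f l) (g l) =
      if f l = g l + x l then (ZMod.stdAddChar (g l * z l) : ℂ) else 0 := by
    rw [clockZ, Matrix.diagonal_pow, Matrix.mul_diagonal, shiftX_pow_apply, Pi.pow_apply,
      rootPow_eq_stdAddChar, ← AddChar.map_nsmul_eq_pow, nsmul_eq_mul, ZMod.natCast_zmod_val]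
    rw [ZMod.natCast_zmod_val, mul_comm (z l)]
    simp
  simp only [tensorMatrix, Matrix.of_apply, h]
  by_cases hfg : f = g + x
  · subst hfg
    simp only [Pi.add_apply, if_true]
    exact (map_prod (ZMod.stdAddChar (N := d)).toMonoidHom
      (fun l => Multiplicative.ofAdd (g l * z l)) Finset.univ).symm
  · obtain ⟨l, hl⟩ := Function.ne_iff.1 hfg
    rw [if_neg hfg]
    exact Finset.prod_eq_zero (Finset.mem_univ l) (if_neg hl)

theorem kronecker_one_injective {ι κ : Type*} [DecidableEq κ] [Nonempty κ] :
    Function.Injective fun M : Matrix ι ι ℂ => M ⊗ₖ (1 : Matrix κ κ ℂ) := by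
  intro M M' h
  ext i j
  obtain ⟨s⟩ := ‹Nonempty κ›
  simpa using congrFun (congrFun h (i, s)) (j, s)

theorem one_kronecker_injective {ι κ : Type*} [DecidableEq ι] [Nonempty ι] :
    Function.Injective fun M : Matrix κ κ ℂ => (1 : Matrix ι ι ℂ) ⊗ₖ M := by
  intro M M' h
  ext i j
  obtain ⟨s⟩ := ‹Nonempty ι›
  simpa using congrFun (congrFun h (s, i)) (s, j)

end Matrices

/-! ### Uniqueness of the Weyl relations -/

section Weyl

variable {H : Type*} [NormedAddCommGroup H] [InnerProductSpace ℂ H] [CompleteSpace H]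
  {d N : ℕ} [NeZero d]

/-- Two unitary representations of `(ℤ/d)^N` with the commutation relations of the operators
`X^{x₁} ⊗ ⋯ ⊗ X^{x_N}` and `Z^{z₁} ⊗ ⋯ ⊗ Z^{z_N}`. -/
structure IsWeylSystem (E F : (Fin N → ZMod d) → unitary (H →L[ℂ] H)) : Prop where
  left_add : ∀ x y, E (x + y) = E x * E y
  right_add : ∀ x y, F (x + y) = F x * F y
  mul_eq : ∀ x z, F z * E x = scalarChar H d (x ⬝ᵥ z) * (E x * F z)

/-- The joint fixed vectors of a family of unitaries. -/
def fixedSpace {ι : Type*} (F : ι → unitary (H →L[ℂ] H)) : Submodule ℂ H where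
  carrier := {v | ∀ z, (F z : H →L[ℂ] H) v = v}
  add_mem' hu hv z := by rw [map_add, hu z, hv z]
  zero_mem' z := map_zero _
  smul_mem' c v hv z := by rw [map_smul, hv z]

theorem sum_stdAddChar_neg_dotProduct (z : Fin N → ZMod d) :
    ∑ f : Fin N → ZMod d, (ZMod.stdAddChar (-(f ⬝ᵥ z)) : ℂ) =
      if z = 0 then (d : ℂ) ^ N else 0 := by
  classical
  let ψ : AddChar (Fin N → ZMod d) ℂ := ZMod.stdAddChar.compAddMonoidHom
    (AddMonoidHom.mk' (fun f => -(f ⬝ᵥ z)) fun f g => by rw [add_dotProduct, neg_add])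
  have hψ (f) : ψ f = ZMod.stdAddChar (-(f ⬝ᵥ z)) := rfl
  have h0 : ψ = 0 ↔ z = 0 := by
    constructor
    · intro h
      ext l
      have h1 : ZMod.stdAddChar (-(Pi.single l 1 ⬝ᵥ z)) = (ZMod.stdAddChar (0 : ZMod d) : ℂ) := by
        rw [← hψ, h, AddChar.zero_apply, AddChar.map_zero_eq_one]
      simpa using ZMod.injective_stdAddChar h1
    · rintro rfl
      ext f
      simp [hψ]
  simp_rw [← hψ, AddChar.sum_eq_ite, h0]
  simp

namespace IsWeylSystem

variable {E F : (Fin N → ZMod d) → unitary (H →L[ℂ] H)}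

theorem left_add_apply (h : IsWeylSystem E F) (x y : Fin N → ZMod d) (v : H) :
    (E x : H →L[ℂ] H) ((E y : H →L[ℂ] H) v) = (E (x + y) : H →L[ℂ] H) v := by
  rw [h.left_add]; rfl

theorem right_add_apply (h : IsWeylSystem E F) (x y : Fin N → ZMod d) (v : H) :
    (F x : H →L[ℂ] H) ((F y : H →L[ℂ] H) v) = (F (x + y) : H →L[ℂ] H) v := by
  rw [h.right_add]; rfl

theorem left_zero (h : IsWeylSystem E F) : E 0 = 1 := by
  simpa using h.left_add 0 0

theorem right_zero (h : IsWeylSystem E F) : F 0 = 1 := by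
  simpa using h.right_add 0 0

theorem swap_apply (h : IsWeylSystem E F) (x z : Fin N → ZMod d) (v : H) :
    (F z : H →L[ℂ] H) ((E x : H →L[ℂ] H) v) =
      (ZMod.stdAddChar (x ⬝ᵥ z) : ℂ) • (E x : H →L[ℂ] H) ((F z : H →L[ℂ] H) v) := by
  have h1 := congrArg (fun g : unitary (H →L[ℂ] H) => (g : H →L[ℂ] H) v) (h.mul_eq x z)
  simpa [coe_scalarChar] using h1

/-- `E x` maps the joint fixed space of `F` to its joint eigenspace of weight `x`. -/
theorem apply_of_mem_fixedSpace (h : IsWeylSystem E F) {u : H} (hu : u ∈ fixedSpace F)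
    (x z : Fin N → ZMod d) : (F z : H →L[ℂ] H) ((E x : H →L[ℂ] H) u) =
      (ZMod.stdAddChar (x ⬝ᵥ z) : ℂ) • (E x : H →L[ℂ] H) u := by
  rw [h.swap_apply, hu z]

/-- The weight spaces span: a vector is the sum of its Fourier components. -/
theorem exists_sum_eq (h : IsWeylSystem E F) (v : H) :
    ∃ u : (Fin N → ZMod d) → fixedSpace F, v = ∑ f, (E f : H →L[ℂ] H) (u f) := by
  let c (f : Fin N → ZMod d) : H :=
    ((d : ℂ) ^ N)⁻¹ • ∑ z, (ZMod.stdAddChar (-(f ⬝ᵥ z)) : ℂ) • (F z : H →L[ℂ] H) v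
  have hc (f w) : (F w : H →L[ℂ] H) (c f) = (ZMod.stdAddChar (f ⬝ᵥ w) : ℂ) • c f := by
    simp only [c, map_smul, map_sum, h.right_add_apply]
    rw [smul_comm (ZMod.stdAddChar (f ⬝ᵥ w) : ℂ),
      Finset.smul_sum (r := (ZMod.stdAddChar (f ⬝ᵥ w) : ℂ))]
    refine congrArg (fun v : H => ((d : ℂ) ^ N)⁻¹ • v)
      (Fintype.sum_equiv (Equiv.addLeft w) _ _ fun z => ?_)
    rw [Equiv.coe_addLeft, smul_smul, ← AddChar.map_add_eq_mul, dotProduct_add]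
    congr 3
    ring
  refine ⟨fun f => ⟨(E (-f) : H →L[ℂ] H) (c f), fun w => ?_⟩, ?_⟩
  · rw [h.swap_apply, hc, map_smul, smul_smul, ← AddChar.map_add_eq_mul, neg_dotProduct,
      neg_add_cancel, AddChar.map_zero_eq_one, one_smul]
  · have hd : (d : ℂ) ^ N ≠ 0 := pow_ne_zero _ (Nat.cast_ne_zero.2 (NeZero.ne d))
    simp only [h.left_add_apply, add_neg_cancel, h.left_zero, OneMemClass.coe_one,
      one_apply_eq_self, c]
    rw [← Finset.smul_sum (s := (Finset.univ : Finset (Fin N → ZMod d))), Finset.sum_comm]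
    simp_rw [← Finset.sum_smul, sum_stdAddChar_neg_dotProduct, ite_smul, zero_smul]
    rw [Finset.sum_ite_eq' Finset.univ (0 : Fin N → ZMod d), if_pos (Finset.mem_univ _),
      h.right_zero, smul_smul, inv_mul_cancel₀ hd, one_smul]
    rfl

theorem inner_left_of_ne (h : IsWeylSystem E F) {u v : H} (hu : u ∈ fixedSpace F)
    (hv : v ∈ fixedSpace F) {x y : Fin N → ZMod d} (hxy : x ≠ y) :
    inner ℂ ((E x : H →L[ℂ] H) u) ((E y : H →L[ℂ] H) v) = 0 := by
  obtain ⟨l, hl⟩ := Function.ne_iff.1 hxy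
  have h1 := ContinuousLinearMap.inner_map_map_of_mem_unitary (F (Pi.single l 1)).2
    ((E x : H →L[ℂ] H) u) ((E y : H →L[ℂ] H) v)
  rw [h.apply_of_mem_fixedSpace hu, h.apply_of_mem_fixedSpace hv, inner_smul_left,
    inner_smul_right, ← mul_assoc] at h1
  by_contra hne
  have h2 := mul_eq_right₀ hne |>.1 h1
  rw [dotProduct_single_one, dotProduct_single_one, ZMod.stdAddChar_apply, ZMod.stdAddChar_apply,
    ← Circle.coe_inv_eq_conj, ← AddChar.map_neg_eq_inv, ← Circle.coe_mul,
    ← AddChar.map_add_eq_mul, Circle.coe_eq_one,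
    ← AddChar.map_zero_eq_one (ZMod.toCircle (N := d))] at h2
  exact hl (neg_add_eq_zero.1 (ZMod.injective_toCircle h2))

variable [FiniteDimensional ℂ H]

/-- The vectors `E f uₛ`, for an orthonormal basis `(uₛ)` of the joint fixed space of `F`. In this
basis a Weyl system consists of Pauli matrices. -/
noncomputable def basis (h : IsWeylSystem E F) :
    OrthonormalBasis ((Fin N → ZMod d) × Fin (Module.finrank ℂ (fixedSpace F))) ℂ H :=
  OrthonormalBasis.mk (v := fun p => (E p.1 : H →L[ℂ] H) (stdOrthonormalBasis ℂ (fixedSpace F) p.2))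
    (by
      rw [orthonormal_iff_ite]
      rintro ⟨f, s⟩ ⟨g, t⟩
      by_cases hfg : f = g
      · subst hfg
        rw [ContinuousLinearMap.inner_map_map_of_mem_unitary (E f).2, ← Submodule.coe_inner,
          orthonormal_iff_ite.1 (stdOrthonormalBasis ℂ (fixedSpace F)).orthonormal]
        simp
      · rw [if_neg (by simp [hfg])]
        exact h.inner_left_of_ne (Subtype.mem _) (Subtype.mem _) hfg)
    (by
      rintro v -
      obtain ⟨u, rfl⟩ := h.exists_sum_eq v
      refine Submodule.sum_mem _ fun f _ => ?_
      rw [← (stdOrthonormalBasis ℂ (fixedSpace F)).sum_repr (u f), Submodule.coe_sum, map_sum]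
      refine Submodule.sum_mem _ fun s _ => ?_
      rw [Submodule.coe_smul, map_smul]
      exact Submodule.smul_mem _ _ (Submodule.subset_span ⟨(f, s), rfl⟩))

theorem basis_apply (h : IsWeylSystem E F) (p) : h.basis p =
    (E p.1 : H →L[ℂ] H) (stdOrthonormalBasis ℂ (fixedSpace F) p.2) := by
  rw [basis, OrthonormalBasis.coe_mk]

theorem conj_mul (h : IsWeylSystem E F) (x z : Fin N → ZMod d) :
    h.basis.repr.conjStarAlgEquiv ((E x * F z : unitary (H →L[ℂ] H)) : H →L[ℂ] H) =
      Matrix.toEuclideanCLM (𝕜 := ℂ)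
        (tensorMatrix (fun l => shiftX d ^ (x l).val * clockZ d ^ (z l).val) ⊗ₖ 1) := by
  refine conj_repr_eq_toEuclideanCLM _ fun ⟨g, s⟩ => ?_
  rw [basis_apply]
  change (E x : H →L[ℂ] H) ((F z : H →L[ℂ] H) ((E g : H →L[ℂ] H) _)) = _
  rw [h.apply_of_mem_fixedSpace (Subtype.mem _), map_smul, h.left_add_apply, add_comm x,
    Finset.sum_eq_single (g + x, s)]
  · simp [tensorMatrix_pauli_apply, basis_apply]
  · rintro ⟨f, t⟩ - hne
    rw [Matrix.kronecker_apply, tensorMatrix_pauli_apply, Matrix.one_apply]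
    split_ifs with h1 h2
    · exact absurd (Prod.ext h1 h2) hne
    all_goals simp
  · simp

/-- The commutant of a Weyl system consists of operators on the second tensor factor. -/
theorem exists_conj_eq_one_kronecker (h : IsWeylSystem E F) {R : H →L[ℂ] H}
    (hE : ∀ x, Commute R (E x)) (hF : ∀ z, Commute R (F z)) :
    ∃ C, h.basis.repr.conjStarAlgEquiv R = Matrix.toEuclideanCLM (𝕜 := ℂ) (1 ⊗ₖ C) := by
  let b := stdOrthonormalBasis ℂ (fixedSpace F)
  have hE' (x v) : R ((E x : H →L[ℂ] H) v) = (E x : H →L[ℂ] H) (R v) :=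
    congrArg (fun A : H →L[ℂ] H => A v) (hE x).eq
  have hR (s) : R (b s) ∈ fixedSpace F := fun z => by
    have h1 : R ((F z : H →L[ℂ] H) (b s)) = (F z : H →L[ℂ] H) (R (b s)) :=
      congrArg (fun A : H →L[ℂ] H => A (b s)) (hF z).eq
    rw [← h1, (b s).2 z]
  refine ⟨Matrix.of fun t s => b.repr ⟨R (b s), hR s⟩ t, conj_repr_eq_toEuclideanCLM _ ?_⟩
  rintro ⟨g, s⟩
  have h1 : R (b s) = ∑ t, b.repr ⟨R (b s), hR s⟩ t • (b t : H) := by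
    simpa using congrArg (Subtype.val) (b.sum_repr ⟨R (b s), hR s⟩).symm
  rw [basis_apply, hE']
  change (E g : H →L[ℂ] H) (R (b s)) = _
  conv_lhs => rw [h1]
  rw [Fintype.sum_prod_type, Finset.sum_eq_single g]
  · simp [basis_apply, b]
  · intro f _ hf
    simp [hf]
  · simp

end IsWeylSystem

end Weyl

/-! ### Decomposition of the generated operators -/

section Decomposition

variable {H : Type*} [NormedAddCommGroup H] [InnerProductSpace ℂ H] [CompleteSpace H]
  {d k : ℕ}

theorem scalarChar_injective [Nontrivial H] [NeZero d] :
    Function.Injective (scalarChar H d) := by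
  intro c c' h
  have h1 : (ZMod.stdAddChar c : ℂ) • (1 : H →L[ℂ] H) = (ZMod.stdAddChar c' : ℂ) • 1 :=
    congrArg Subtype.val h
  exact ZMod.injective_stdAddChar (smul_left_injective ℂ one_ne_zero h1)

theorem zmod_two_eq_one_of_ne_zero : ∀ c : ZMod 2, c ≠ 0 → c = 1 := by decide

theorem stdAddChar_two_one : (ZMod.stdAddChar (1 : ZMod 2) : ℂ) = -1 := by
  have h := ZMod.stdAddChar_coe (N := 2) 1
  rw [Int.cast_one] at h
  rw [h, ← Complex.exp_pi_mul_I]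
  congr 1
  push_cast
  ring

variable {T : Fin k → unitary (H →L[ℂ] H)}

theorem IsGeneratingGraph.mul_eq [NeZero d] {γ : Matrix (Fin k) (Fin k) (ZMod d)}
    (hγ : IsGeneratingGraph d T γ) (i j : Fin k) :
    T i * T j = scalarChar H d (γ i j) * (T j * T i) := by
  have h : T i * T j * (T i)⁻¹ * (T j)⁻¹ = scalarChar H d (γ i j) :=
    Subtype.ext (by rw [hγ i j, rootPow_eq_stdAddChar, coe_scalarChar])
  rw [← h]
  group

theorem twistedProduct_word [NeZero d] (I : Fin k → ZMod d) :
    TwistedProduct (scalarChar H d) T (word T I) I := by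
  have h := TwistedProduct.orderedProd (ζ := scalarChar H d) (T := T)
    (fun i => TwistedProduct.of i) I
  have hI : ∑ i, I i • (Pi.single i 1 : Fin k → ZMod d) = I := by
    ext j
    simp [Pi.single_apply]
  rwa [hI] at h

theorem IsGeneratingGraph.isAlt [Nontrivial H] [NeZero d] {γ : Matrix (Fin k) (Fin k) (ZMod d)}
    (hγ : IsGeneratingGraph d T γ) : γ.toBilin'.IsAlt := by
  intro u
  have h := (twistedProduct_word (T := T) u).mul_eq scalarChar_commute hγ.mul_eq
    (twistedProduct_word u)
  refine scalarChar_injective (H := H) ?_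
  rw [AddChar.map_zero_eq_one]
  have h1 := congrArg (· * (word T u * word T u)⁻¹) h
  simpa only [mul_inv_cancel_right, mul_inv_cancel] using h1.symm

variable [Fact d.Prime] {γ : Matrix (Fin k) (Fin k) (ZMod d)}

/-- A phase in `{1, i}` turns every product of the generators into an operator of order dividing
`d`. For odd `d` the phase `1` will do, because `d` divides `d(d-1)/2`. -/
theorem TwistedProduct.exists_phase (hγ : IsGeneratingGraph d T γ) (hT : ∀ i, T i ^ d = 1)
    {a : unitary (H →L[ℂ] H)} {v : Fin k → ZMod d}
    (ha : TwistedProduct (scalarChar H d) T a v) :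
    ∃ (μ : ℂ) (g : unitary (H →L[ℂ] H)), (μ = 1 ∨ μ = Complex.I) ∧ (g : H →L[ℂ] H) = μ • 1 ∧
      TwistedProduct (scalarChar H d) T g 0 ∧ (g * a) ^ d = 1 := by
  obtain ⟨c, hc⟩ := ha.exists_pow_eq scalarChar_commute hγ.mul_eq hT
  by_cases h1 : a ^ d = 1
  · exact ⟨1, 1, Or.inl rfl, by simp, .one, by simpa⟩
  rcases (Fact.out : d.Prime).eq_two_or_odd' with rfl | hodd
  · have hc1 : c = 1 := by
      have hc0 : c ≠ 0 := by
        rintro rfl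
        exact h1 (by rw [hc, mul_zero, AddChar.map_zero_eq_one])
      exact zmod_two_eq_one_of_ne_zero c hc0
    let z : Circle := ⟨Complex.I, by simp [Submonoid.unitSphere]⟩
    have hz : scalarUnitary H z ^ 2 = scalarChar H 2 1 := by
      refine Subtype.ext ?_
      rw [← map_pow, coe_scalarUnitary, coe_scalarChar, stdAddChar_two_one, Circle.coe_pow]
      simp [z]
    refine ⟨Complex.I, scalarUnitary H z, Or.inr rfl, rfl,
      .central _ (scalarUnitary_commute z) ⟨1, by simpa using hz⟩, ?_⟩
    rw [(scalarUnitary_commute z a).mul_pow, hz, hc, hc1, ← AddChar.map_add_eq_mul,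
      ← AddChar.map_zero_eq_one (scalarChar H 2)]
    congr 1
  · have hq : ((d.choose 2 : ℕ) : ZMod d) = 0 := by
      rw [ZMod.natCast_eq_zero_iff]
      exact (Fact.out : d.Prime).dvd_choose_self two_ne_zero
        (lt_of_le_of_ne (Fact.out : d.Prime).two_le fun h => by
          rw [← h] at hodd
          exact absurd hodd (by decide))
    exact absurd (by rw [hc, hq, zero_mul, AddChar.map_zero_eq_one]) h1

theorem exists_twistedProduct_eq_element [Nontrivial H] (hγ : IsGeneratingGraph d T γ)
    (hT : ∀ i, T i ^ d = 1) (I : Fin k → ZMod d) :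
    ∃ a : unitary (H →L[ℂ] H), TwistedProduct (scalarChar H d) T a I ∧ a ^ d = 1 ∧
      element T I = a := by
  obtain ⟨μ, g, hμ, hg, hgT, hpow⟩ :=
    (twistedProduct_word (T := T) I).exists_phase hγ hT
  have hcoe : ((g * word T I : unitary (H →L[ℂ] H)) : H →L[ℂ] H) =
      μ • (word T I : H →L[ℂ] H) := by
    rw [Submonoid.coe_mul, hg, smul_one_mul]
  refine ⟨g * word T I, by simpa using hgT.mul (twistedProduct_word I), hpow, ?_⟩
  rw [hcoe]
  refine (element_eq_of_pow_eq_one Fact.out T I μ hμ ?_).symm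
  rw [← hcoe, ← SubmonoidClass.coe_pow, hpow, OneMemClass.coe_one]

/-- Representatives of a symplectic family of exponent vectors generate a Weyl system. -/
theorem isWeylSystem_orderedProd (hγ : IsGeneratingGraph d T γ) {N : ℕ}
    {e f : Fin N → Fin k → ZMod d} (hef : IsSymplecticFamily γ.toBilin' e f)
    {a b : Fin N → unitary (H →L[ℂ] H)}
    (ha : ∀ l, TwistedProduct (scalarChar H d) T (a l) (e l)) (had : ∀ l, a l ^ d = 1)
    (hb : ∀ l, TwistedProduct (scalarChar H d) T (b l) (f l)) (hbd : ∀ l, b l ^ d = 1) :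
    IsWeylSystem (orderedProd (d := d) a) (orderedProd (d := d) b) where
  left_add := orderedProd_add had fun i j =>
    (ha i).commute scalarChar_commute hγ.mul_eq (ha j) (hef.left i j)
  right_add := orderedProd_add hbd fun i j =>
    (hb i).commute scalarChar_commute hγ.mul_eq (hb j) (hef.right i j)
  mul_eq x z := by
    rw [(TwistedProduct.orderedProd hb z).mul_eq scalarChar_commute hγ.mul_eq
      (TwistedProduct.orderedProd ha x)]
    congr 2
    rw [map_sum (γ.toBilin'), LinearMap.sum_apply]
    simp_rw [map_smul (γ.toBilin'), LinearMap.smul_apply, hef.apply_left_sum]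
    simp [dotProduct, mul_comm]

end Decomposition

/-! ### Factors of Kronecker products with an identity matrix -/

section KroneckerFactors

variable {ι κ : Type*} [Fintype ι] [Fintype κ] [DecidableEq ι]

theorem commute_of_one_kronecker [Nonempty ι] {M M' : Matrix κ κ ℂ}
    (h : Commute ((1 : Matrix ι ι ℂ) ⊗ₖ M) (1 ⊗ₖ M')) : Commute M M' := by
  refine one_kronecker_injective (ι := ι) ?_
  simpa [commute_iff_eq, ← Matrix.mul_kronecker_mul] using h

variable [DecidableEq κ]

theorem pow_eq_one_of_kronecker_one [Nonempty κ] {M : Matrix ι ι ℂ} {n : ℕ}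
    (h : (M ⊗ₖ (1 : Matrix κ κ ℂ)) ^ n = 1) : M ^ n = 1 := by
  have hp (n : ℕ) : (M ⊗ₖ (1 : Matrix κ κ ℂ)) ^ n = (M ^ n) ⊗ₖ 1 := by
    induction n with
    | zero => simp
    | succ n ih => rw [pow_succ, ih, ← Matrix.mul_kronecker_mul, one_mul, ← pow_succ]
  rw [hp, ← Matrix.one_kronecker_one] at h
  exact kronecker_one_injective h

theorem pow_eq_one_of_one_kronecker [Nonempty ι] {M : Matrix κ κ ℂ} {n : ℕ}
    (h : ((1 : Matrix ι ι ℂ) ⊗ₖ M) ^ n = 1) : M ^ n = 1 := by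
  have hp (n : ℕ) : ((1 : Matrix ι ι ℂ) ⊗ₖ M) ^ n = 1 ⊗ₖ (M ^ n) := by
    induction n with
    | zero => simp
    | succ n ih => rw [pow_succ, ih, ← Matrix.mul_kronecker_mul, one_mul, ← pow_succ]
  rw [hp, ← Matrix.one_kronecker_one] at h
  exact one_kronecker_injective h

theorem mem_unitaryGroup_of_one_kronecker [Nonempty ι] {M : Matrix κ κ ℂ}
    (h : (1 : Matrix ι ι ℂ) ⊗ₖ M ∈ Matrix.unitaryGroup (ι × κ) ℂ) :
    M ∈ Matrix.unitaryGroup κ ℂ := by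
  rw [Matrix.mem_unitaryGroup_iff] at h ⊢
  refine one_kronecker_injective (ι := ι) ?_
  rw [Matrix.star_eq_conjTranspose, Matrix.conjTranspose_kronecker, ← Matrix.mul_kronecker_mul,
    Matrix.conjTranspose_one, one_mul] at h
  simpa [Matrix.star_eq_conjTranspose] using h

end KroneckerFactors

end FrustrationGraph

open FrustrationGraph in
theorem theorem1 {d : ℕ} [Fact d.Prime]
    {H : Type*} [NormedAddCommGroup H] [InnerProductSpace ℂ H] [CompleteSpace H]
    [FiniteDimensional ℂ H] [Nontrivial H]
    {k : ℕ} (T : Fin k → unitary (H →L[ℂ] H)) (hT : ∀ i, T i ^ d = 1)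
    (γ : Matrix (Fin k) (Fin k) (ZMod d)) (hγ : FrustrationGraph.IsGeneratingGraph d T γ) :
    ∃ N r : ℕ, γ.rank = 2 * N ∧
      ∃ U : H ≃ₗᵢ[ℂ] EuclideanSpace ℂ ((Fin N → ZMod d) × Fin r),
      ∃ P : (H →L[ℂ] H) → Matrix (Fin N → ZMod d) (Fin N → ZMod d) ℂ,
      ∃ C : (H →L[ℂ] H) → Matrix (Fin r) (Fin r) ℂ,
        (∀ A ∈ FrustrationGraph.generatedSet d T,
          (U : H →L[ℂ] EuclideanSpace ℂ ((Fin N → ZMod d) × Fin r)) ∘L A ∘L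
              (U.symm : EuclideanSpace ℂ ((Fin N → ZMod d) × Fin r) →L[ℂ] H) =
            Matrix.toEuclideanCLM (𝕜 := ℂ) (P A ⊗ₖ C A) ∧
          P A ∈ FrustrationGraph.pauliSet d N ∧
          C A ∈ Matrix.unitaryGroup (Fin r) ℂ ∧
          C A ^ d = 1) ∧
        (∀ A ∈ FrustrationGraph.generatedSet d T,
          ∀ A' ∈ FrustrationGraph.generatedSet d T, Commute (C A) (C A')) := by
  classical
  have hB := hγ.isAlt
  obtain ⟨N, e, f, hef, hrad⟩ := exists_isSymplecticFamily hB
  choose a haT had hael using exists_twistedProduct_eq_element hγ hT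
  have hW := isWeylSystem_orderedProd hγ hef (fun l => haT (e l)) (fun l => had (e l))
    (fun l => haT (f l)) (fun l => had (f l))
  have hET := TwistedProduct.orderedProd (fun l => haT (e l))
  have hFT := TwistedProduct.orderedProd (fun l => haT (f l))
  set E := orderedProd (d := d) fun l => a (e l)
  set F := orderedProd (d := d) fun l => a (f l)
  set U := hW.basis.repr
  have : Nonempty (Fin (Module.finrank ℂ (fixedSpace F))) :=
    (hW.basis.toBasis.index_nonempty).map Prod.snd
  let Φ := U.conjStarAlgEquiv.trans (Matrix.toEuclideanCLM (𝕜 := ℂ)).symm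
  have hΦ {A M} : Φ A = M ↔ U.conjStarAlgEquiv A = Matrix.toEuclideanCLM (𝕜 := ℂ) M :=
    (Matrix.toEuclideanCLM (𝕜 := ℂ)).toEquiv.symm_apply_eq
  -- `A_I` is the product of a Pauli operator `s` with the same commutators with the Weyl system
  -- and an operator `R` whose exponent vector lies in the radical.
  have key (I : Fin k → ZMod d) : ∃ P C R v, P ∈ pauliSet d N ∧ Φ (element T I) = P ⊗ₖ C ∧
      Φ ((R : unitary (H →L[ℂ] H)) : H →L[ℂ] H) = 1 ⊗ₖ C ∧ R ^ d = 1 ∧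
      TwistedProduct (scalarChar H d) T R v ∧ ∀ w, γ.toBilin' v w = 0 := by
    let x : Fin N → ZMod d := fun l => γ.toBilin' (f l) I
    let z : Fin N → ZMod d := fun l => γ.toBilin' I (e l)
    obtain ⟨μ, g, hμ, hg, hgT, hpow⟩ := ((hET x).mul (hFT z)).exists_phase hγ hT
    have hsT := hgT.mul ((hET x).mul (hFT z))
    set s := g * (E x * F z)
    have hRT := (hsT.inv (Fact.out : d.Prime).pos hpow).mul (haT I)
    have hv : -(0 + (∑ l, x l • e l + ∑ l, z l • f l)) + I =
        symplecticRemainder γ.toBilin' e f I := by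
      rw [symplecticRemainder, zero_add, neg_add_eq_sub]
    rw [hv] at hRT
    set R := s⁻¹ * a I
    have hv0 := hrad _ (hef.apply_remainder_left hB I) (hef.apply_remainder_right I)
    have hcomm {b v} (hb : TwistedProduct (scalarChar H d) T b v) : Commute R b :=
      hRT.commute scalarChar_commute hγ.mul_eq hb (hv0 v)
    have haI : a I = s * R := (mul_inv_cancel_left s (a I)).symm
    have hRd : R ^ d = 1 := by
      have h := had I
      rwa [haI, ((hcomm hsT).symm).mul_pow, hpow, one_mul] at h
    obtain ⟨C, hC⟩ := hW.exists_conj_eq_one_kronecker (R := R)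
      (fun x => congrArg Subtype.val (hcomm (hET x)).eq)
      (fun z => congrArg Subtype.val (hcomm (hFT z)).eq)
    rw [← hΦ] at hC
    set t := tensorMatrix fun l => shiftX d ^ (x l).val * clockZ d ^ (z l).val with ht
    have hs : Φ (s : H →L[ℂ] H) = (μ • t) ⊗ₖ 1 := by
      rw [Submonoid.coe_mul, hg, smul_one_mul, map_smul, hΦ.2 (hW.conj_mul x z),
        Matrix.smul_kronecker]
    refine ⟨μ • t, C, R, _, ⟨x, z, μ, hμ, rfl, ?_⟩, ?_, hC, hRd, hRT, hv0⟩
    · refine pow_eq_one_of_kronecker_one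
        (κ := Fin (Module.finrank ℂ (fixedSpace F))) ?_
      rw [← hs, ← map_pow, ← SubmonoidClass.coe_pow, hpow, OneMemClass.coe_one, map_one]
    · rw [hael, haI, Submonoid.coe_mul, map_mul, hs, hC, ← Matrix.mul_kronecker_mul, one_mul,
        mul_one]
  choose P C R v hP hPC hC hRd hRT hv using key
  -- Different `I` may give the same operator, so an index is chosen for each operator.
  let J := Function.invFun (element T (d := d))
  refine ⟨N, _, hef.rank_eq hB hrad, U, fun A => P (J A), fun A => C (J A),
    fun A hA => ⟨?_, hP _, ?_, ?_⟩, fun A _ A' _ => ?_⟩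
  · have hJ : element T (J A) = A := Function.invFun_eq hA
    rw [← hΦ.1 (hPC (J A)), hJ]
    rfl
  · refine mem_unitaryGroup_of_one_kronecker (ι := Fin N → ZMod d) ?_
    rw [← hC]
    exact Unitary.map_mem Φ (R (J A)).2
  · refine pow_eq_one_of_one_kronecker (ι := Fin N → ZMod d) ?_
    rw [← hC, ← map_pow, ← SubmonoidClass.coe_pow, hRd, OneMemClass.coe_one, map_one]
  · refine commute_of_one_kronecker (ι := Fin N → ZMod d) ?_
    rw [← hC, ← hC]
    have h := (hRT (J A)).commute scalarChar_commute hγ.mul_eq (hRT (J A')) (hv _ _)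
    exact Commute.map (f := Φ) (congrArg Subtype.val h.eq)
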